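/- A \emph{random walk on the quadrant} $\mathbb N^2$ ($0\in\mathbb N$) is a time-homogeneous Markov chain on $\mathbb N^2$ that at each step moves to one of the states immediately left, right, up or down of the current state; the four probabilities may depend on the state, and moves leaving $\mathbb N^2$ have probability $0$. It is \emph{elliptic} if every move that stays in $\mathbb N^2$ has positive probability, and \emph{maximally homogeneous} if its transition probabilities are constant on each of the four regions $\{(0,0)\}$, $\{(i,0):i\ge 1\}$, $\{(0,j):j\ge1\}$, $\{(i,j):i,j\ge 1\}$. It is \emph{recurrent} (respectively \emph{transient}) if for every state $z$ the walk started at $z$ returns to $z$ with probability $1$ (respectively less than $1$), and \emph{positive recurrent} if for every $z$ the expected return time to $z$ is finite. Write $X\preceq Y$ if at each state the probabilities of going down and of going left are at least as large in $X$ as in $Y$, and the probabilities of going up and of going right are at most as large in $X$ as in $Y$. \textbf{Theorem.} There are two elliptic, irreducible, maximally homogeneous random walks $X\preceq Y$ on $\mathbb N^2$ such that $Y$ is positive recurrent and $X$ is transient. Explicitly, one may take the following transition probabilities (left, right, up, down): \[ \begin{array}{c|c|c} & X & Y\\ \hline (0,0) & 0,\ \frac{9}{14},\ \frac{5}{14},\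 0 & 0,\ \frac{9}{14},\ \frac{5}{14},\ 0\\ (i,0),\ i\ge1 & \frac1{10},\ \frac{41}{100},\ \frac{49}{100},\ 0 & \frac1{12},\ \frac5{12},\ \frac12,\ 0\\ (0,j),\ j\ge1 & 0,\ \frac1{25},\ \frac5{25},\ \frac{19}{25} & 0,\ \frac1{20},\ \frac5{24},\ \frac{89}{120}\\ (i,j),\ i,j\ge1 & \frac{21}{100},\ \frac4{100},\ \frac1{100},\ \frac{74}{100} & \frac5{24},\ \frac1{24},\ \frac38,\ \frac38 \end{array} \] For this choice, a stationary probability distribution of $Y$ is \[ \pi_{i,j}=\frac1Z\Big(\frac57\Big)^{i+j}c_{i,j},\qquad c_{i,j}=\begin{cases}1 & i,j\ge1\\ \frac34 & j=0,\ i\ge1\\ \frac56 & i=0,\ j\ge1\\ \frac{35}{72} & i=j=0,\end{cases} \] where $Z<\infty$ is the normalizing constant. In particular, recurrence is not monotone under $\preceq$: it is not true that for all irreducible random walks $X\preceq Y$ on $\mathbb N^2$, if $Y$ is recurrent then $X$ is recurrent. -/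

import Mathlib

open MeasureTheory ProbabilityTheory
open scoped NNReal ENNReal

/-- A (non-homogeneous, nearest-neighbour) random walk on the quadrant `ℕ²`, given by the
probabilities of moving left, right, up and down from each state. Moves that would leave the
quadrant have probability zero. -/
structure QuadrantWalk where
  left : ℕ × ℕ → ℝ≥0
  right : ℕ × ℕ → ℝ≥0
  up : ℕ × ℕ → ℝ≥0
  down : ℕ × ℕ → ℝ≥0
  sum_eq_one : ∀ z, left z + right z + up z + down z = 1
  left_boundary : ∀ j, left (0, j) = 0
  down_boundary : ∀ i, down (i, 0) = 0

namespace QuadrantWalk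

/-- The law of the next position of the walk from `z`. The truncated subtractions are harmless,
since the corresponding weights vanish on the boundary. -/
noncomputable def step (W : QuadrantWalk) (z : ℕ × ℕ) : Measure (ℕ × ℕ) :=
  (W.left z : ℝ≥0∞) • Measure.dirac (z.1 - 1, z.2) +
  (W.right z : ℝ≥0∞) • Measure.dirac (z.1 + 1, z.2) +
  (W.up z : ℝ≥0∞) • Measure.dirac (z.1, z.2 + 1) +
  (W.down z : ℝ≥0∞) • Measure.dirac (z.1, z.2 - 1)

instance (W : QuadrantWalk) (z : ℕ × ℕ) : IsProbabilityMeasure (W.step z) where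
  measure_univ := by
    have h := congrArg (fun t : ℝ≥0 => (t : ℝ≥0∞)) (W.sum_eq_one z)
    simpa [step] using h

/-- The transition kernel of the walk. -/
noncomputable def kernel (W : QuadrantWalk) : Kernel (ℕ × ℕ) (ℕ × ℕ) where
  toFun := W.step
  measurable' := measurable_of_countable _

instance (W : QuadrantWalk) : IsMarkovKernel W.kernel where
  isProbabilityMeasure z := inferInstanceAs (IsProbabilityMeasure (W.step z))

/-- The conditional law of the position at time `n + 1` given the positions at times `0, …, n`:
it depends on the position at time `n` only. -/
noncomputable def historyKernel (W : QuadrantWalk) (n : ℕ) :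
    Kernel (Π _ : Finset.Iic n, ℕ × ℕ) (ℕ × ℕ) :=
  W.kernel.comap (fun h => h ⟨n, Finset.mem_Iic.2 le_rfl⟩) (measurable_pi_apply _)

instance (W : QuadrantWalk) (n : ℕ) : IsMarkovKernel (W.historyKernel n) :=
  inferInstanceAs (IsMarkovKernel (W.kernel.comap _ _))

/-- The law, on the space of trajectories, of the walk started at `z`. -/
noncomputable def pathLaw (W : QuadrantWalk) (z : ℕ × ℕ) : Measure (ℕ → ℕ × ℕ) :=
  Kernel.trajMeasure (X := fun _ => ℕ × ℕ) (Measure.dirac z) W.historyKernel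

/-- The first time `n ≥ 1` at which the trajectory `ω` is at `z` (`∞` if there is none). -/
noncomputable def returnTime (z : ℕ × ℕ) (ω : ℕ → ℕ × ℕ) : ℝ≥0∞ :=
  ⨅ (n : ℕ) (_ : 1 ≤ n ∧ ω n = z), (n : ℝ≥0∞)

/-- Every state is reached from every state with positive probability. -/
def IsIrreducible (W : QuadrantWalk) : Prop :=
  ∀ z w, ∃ n : ℕ, 0 < W.pathLaw z {ω | ω n = w}

/-- From every state, the walk almost surely returns to that state. -/
def IsRecurrent (W : QuadrantWalk) : Prop :=
  ∀ z, W.pathLaw z {ω | ∃ n, 1 ≤ n ∧ ω n = z} = 1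

/-- From every state, the expected return time to that state is finite. -/
def IsPositiveRecurrent (W : QuadrantWalk) : Prop :=
  ∀ z, ∫⁻ ω, returnTime z ω ∂(W.pathLaw z) < ∞

/-- From every state, the probability of ever returning to that state is less than one. -/
def IsTransient (W : QuadrantWalk) : Prop :=
  ∀ z, W.pathLaw z {ω | ∃ n, 1 ≤ n ∧ ω n = z} < 1

/-- All possible transitions have positive probability. -/
def IsElliptic (W : QuadrantWalk) : Prop :=
  ∀ z, 0 < W.right z ∧ 0 < W.up z ∧ (1 ≤ z.1 → 0 < W.left z) ∧ (1 ≤ z.2 → 0 < W.down z)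

/-- The transition probabilities are constant on each of the four regions
`{(0, 0)}`, `{(i, 0) : i ≥ 1}`, `{(0, j) : j ≥ 1}` and `{(i, j) : i, j ≥ 1}`. -/
def IsMaximallyHomogeneous (W : QuadrantWalk) : Prop :=
  ∀ z z' : ℕ × ℕ, (z.1 = 0 ↔ z'.1 = 0) → (z.2 = 0 ↔ z'.2 = 0) →
    W.left z = W.left z' ∧ W.right z = W.right z' ∧ W.up z = W.up z' ∧ W.down z = W.down z'

/-- `X` goes down and left at least as much as `Y`, and up and right at most as much. -/
def Precedes (X Y : QuadrantWalk) : Prop :=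
  ∀ z, Y.down z ≤ X.down z ∧ Y.left z ≤ X.left z ∧ X.up z ≤ Y.up z ∧ X.right z ≤ Y.right z

end QuadrantWalk

infix:50 " ⪯ " => QuadrantWalk.Precedes

/-- The function on `ℕ²` with value `o` at the origin, `x` on the positive `x`-axis, `y` on the
positive `y`-axis and `q` elsewhere. -/
def onRegions (o x y q : ℝ≥0) : ℕ × ℕ → ℝ≥0
  | (0, 0) => o
  | (_ + 1, 0) => x
  | (0, _ + 1) => y
  | (_ + 1, _ + 1) => q

/-- The unnormalised weights of the stationary distribution. -/
noncomputable def stationaryWeight (z : ℕ × ℕ) : ℝ≥0 :=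
  onRegions (35 / 72) (3 / 4) (5 / 6) 1 z * (5 / 7) ^ (z.1 + z.2)

/-! In both walks the `x`-axis carries the particle to the right and the interior carries it to the
left. The interior of `X` pushes strongly downwards, so `X` is pinned near the `x`-axis and escapes
along it. The interior of `Y` has no vertical drift, so `Y` makes long excursions, drifts left to
the `y`-axis and is brought back down.

Positive recurrence of `Y`: the explicit weights solve the balance equations
(`balance_stationaryWeight`), and Kac's inequality bounds the expected return time to `z` by `1 / π
{z}` (`measure_mul_tsum_pathLaw_stayIn_le`).

Transience of `X`: `min 1 ((9/10)^i (26/25)^j)` is superharmonic and nonconstant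
(`sum_escapeFunction_le`). If some state were recurrent, a nonnegative superharmonic function would
attain its minimum there, and the minimum would spread to all states
(`isTransient_of_superharmonic`). -/

namespace QuadrantWalk

/-! ### Markov property and killed transition operator -/

/-- The trajectories that stay in `A` at the times `1, …, n`. -/
def stayIn (A : Set (ℕ × ℕ)) (n : ℕ) : Set (ℕ → ℕ × ℕ) :=
  {ω | ∀ k, 1 ≤ k → k ≤ n → ω k ∈ A}

/-- The transition operator of the walk killed outside of `A`. -/
noncomputable def killed (W : QuadrantWalk) (A : Set (ℕ × ℕ)) (f : ℕ × ℕ → ℝ≥0∞) (w : ℕ × ℕ) :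
    ℝ≥0∞ :=
  ∫⁻ v in A, f v ∂W.step w

instance (W : QuadrantWalk) (z : ℕ × ℕ) : IsProbabilityMeasure (W.pathLaw z) :=
  inferInstanceAs (IsProbabilityMeasure (Kernel.trajMeasure _ _))

lemma measurableSet_stayIn (A : Set (ℕ × ℕ)) (n : ℕ) : MeasurableSet (stayIn A n) := by
  have : stayIn A n = ⋂ k, ⋂ (_ : 1 ≤ k), ⋂ (_ : k ≤ n), (fun ω : ℕ → ℕ × ℕ => ω k) ⁻¹' A := by
    ext ω; simp [stayIn]
  rw [this]
  exact .iInter fun k => .iInter fun _ => .iInter fun _ =>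
    measurable_pi_apply k A.to_countable.measurableSet

lemma stayIn_zero (A : Set (ℕ × ℕ)) : stayIn A 0 = Set.univ := by
  ext ω; simp only [stayIn, Set.mem_ofPred_eq, Set.mem_univ, iff_true]; omega

lemma stayIn_univ (n : ℕ) : stayIn Set.univ n = Set.univ := by
  ext ω; simp [stayIn]

lemma mem_stayIn_succ {A : Set (ℕ × ℕ)} {n : ℕ} {ω : ℕ → ℕ × ℕ} :
    ω ∈ stayIn A (n + 1) ↔ ω ∈ stayIn A n ∧ ω (n + 1) ∈ A := by
  refine ⟨fun h => ⟨fun k h1 h2 => h k h1 (by omega), h _ (by omega) le_rfl⟩, ?_⟩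
  rintro ⟨h1, h2⟩ k hk hk'
  rcases Nat.lt_or_ge n k with h | h
  · obtain rfl : k = n + 1 := by omega
    exact h2
  · exact h1 k hk h

/-- The walk started at `z` is at `z` at time `0`. -/
lemma map_zero_pathLaw (W : QuadrantWalk) (z : ℕ × ℕ) :
    (W.pathLaw z).map (fun ω => ω 0) = Measure.dirac z := by
  have h : (fun ω : ℕ → ℕ × ℕ => ω 0) =
      (MeasurableEquiv.piUnique (fun _ : Finset.Iic 0 => ℕ × ℕ)) ∘
        Preorder.frestrictLe (π := fun _ => ℕ × ℕ) 0 := by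
    ext ω <;> rfl
  rw [h, ← Measure.map_map (by fun_prop) (by fun_prop), pathLaw, Kernel.trajMeasure,
    Measure.map_comp _ _ (by fun_prop), Kernel.traj_map_frestrictLe, Kernel.partialTraj_self,
    Measure.id_comp, Measure.map_map (by fun_prop) (by fun_prop)]
  simp

/-- The Markov property at time `n`. -/
lemma lintegral_pathLaw_succ (W : QuadrantWalk) (z : ℕ × ℕ) (n : ℕ)
    (F : (Finset.Iic n → ℕ × ℕ) → ℕ × ℕ → ℝ≥0∞) :
    ∫⁻ ω, F (Preorder.frestrictLe (π := fun _ => ℕ × ℕ) n ω) (ω (n + 1)) ∂W.pathLaw z =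
      ∫⁻ ω, ∫⁻ v, F (Preorder.frestrictLe (π := fun _ => ℕ × ℕ) n ω) v ∂W.step (ω n)
        ∂W.pathLaw z := by
  have h := Kernel.map_frestrictLe_trajMeasure_compProd_eq_map_trajMeasure
    (X := fun _ => ℕ × ℕ) (μ₀ := Measure.dirac z) (κ := W.historyKernel) (a := n)
  -- Histories up to time `n` form a countable space, so every `F` is measurable.
  have hF : Measurable (Function.uncurry F) := measurable_of_countable _
  have h1 := congrArg (fun μ => ∫⁻ x, Function.uncurry F x ∂μ) h
  rw [Measure.lintegral_compProd hF, lintegral_map (measurable_of_countable _) (by fun_prop),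
    lintegral_map hF (by fun_prop)] at h1
  exact h1.symm

/-- Expectations of the walk before it leaves `A`, in terms of the killed transition operator. -/
lemma setLIntegral_stayIn (W : QuadrantWalk) (A : Set (ℕ × ℕ)) (z : ℕ × ℕ) (n : ℕ)
    (f : ℕ × ℕ → ℝ≥0∞) :
    ∫⁻ ω in stayIn A n, f (ω n) ∂W.pathLaw z = ((W.killed A)^[n] f) z := by
  classical
  induction n generalizing f with
  | zero =>
    rw [stayIn_zero, Measure.restrict_univ, Function.iterate_zero, id,
      ← lintegral_map (f := f) (g := fun ω : ℕ → ℕ × ℕ => ω 0) (measurable_of_countable _)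
        (by fun_prop), map_zero_pathLaw, lintegral_dirac]
  | succ n ih =>
    -- Conditioning on time `n` replaces `f` by `W.killed A f`, which is why `f` varies in the
    -- induction.
    rw [Function.iterate_succ_apply, ← ih, ← lintegral_indicator (measurableSet_stayIn _ _),
      ← lintegral_indicator (measurableSet_stayIn _ _)]
    have h := W.lintegral_pathLaw_succ z n
      (fun h v => if ∀ k : Finset.Iic n, 1 ≤ k.1 → h k ∈ A then A.indicator f v else 0)
    have hS : ∀ ω : ℕ → ℕ × ℕ, (∀ k : Finset.Iic n, 1 ≤ k.1 →
        Preorder.frestrictLe (π := fun _ => ℕ × ℕ) n ω k ∈ A) ↔ ω ∈ stayIn A n := by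
      intro ω
      simp only [stayIn, Set.mem_ofPred_eq, Preorder.frestrictLe_apply, Subtype.forall,
        Finset.mem_Iic]
      exact ⟨fun h k h1 h2 => h k h2 h1, fun h k h1 h2 => h k h2 h1⟩
    simp only [hS] at h
    convert h using 3 with ω ω
    · by_cases h1 : ω ∈ stayIn A n <;> by_cases h2 : ω (n + 1) ∈ A <;>
        simp [Set.indicator, mem_stayIn_succ, h1, h2]
    · by_cases h1 : ω ∈ stayIn A n
      · simp [h1, killed, lintegral_indicator A.to_countable.measurableSet]
      · simp [h1]

end QuadrantWalk

/-! ### Kac's inequality and positive recurrence -/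

namespace QuadrantWalk

lemma lintegral_step (W : QuadrantWalk) (z : ℕ × ℕ) (f : ℕ × ℕ → ℝ≥0∞) :
    ∫⁻ v, f v ∂W.step z = W.left z * f (z.1 - 1, z.2) + W.right z * f (z.1 + 1, z.2) +
      W.up z * f (z.1, z.2 + 1) + W.down z * f (z.1, z.2 - 1) := by
  simp [step]
  simp only [ENNReal.smul_def, smul_eq_mul]

/-- The probability of staying in `A` at the times `1, …, n`. -/
lemma pathLaw_stayIn (W : QuadrantWalk) (A : Set (ℕ × ℕ)) (z : ℕ × ℕ) (n : ℕ) :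
    W.pathLaw z (stayIn A n) = ((W.killed A)^[n] 1) z := by
  rw [← setLIntegral_stayIn]
  simp

/-- Peeling the outermost factor off the iterated operator gives the decomposition at the first
step, without shifting trajectories. -/
lemma pathLaw_stayIn_succ (W : QuadrantWalk) (A : Set (ℕ × ℕ)) (z : ℕ × ℕ) (n : ℕ) :
    W.pathLaw z (stayIn A (n + 1)) = ∫⁻ v in A, W.pathLaw v (stayIn A n) ∂W.step z := by
  simp only [pathLaw_stayIn, Function.iterate_succ_apply']
  rfl

lemma antitone_stayIn (A : Set (ℕ × ℕ)) : Antitone (stayIn A) :=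
  fun _ _ h _ hω k h1 h2 => hω k h1 (h2.trans h)

lemma compl_setOf_returns (z : ℕ × ℕ) :
    {ω : ℕ → ℕ × ℕ | ∃ n, 1 ≤ n ∧ ω n = z}ᶜ = ⋂ n, stayIn {z}ᶜ n := by
  ext ω
  simp only [stayIn, Set.mem_compl_iff, Set.mem_ofPred_eq, not_exists, not_and, Set.mem_iInter,
    Set.mem_singleton_iff]
  exact ⟨fun h _ k hk _ => h k hk, fun h k hk => h k k hk le_rfl⟩

lemma measurableSet_returns (z : ℕ × ℕ) :
    MeasurableSet {ω : ℕ → ℕ × ℕ | ∃ n, 1 ≤ n ∧ ω n = z} := by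
  rw [← MeasurableSet.compl_iff, compl_setOf_returns]
  exact .iInter fun n => measurableSet_stayIn _ n

/-- Kac's inequality. -/
lemma measure_mul_tsum_pathLaw_stayIn_le (W : QuadrantWalk) (π : Measure (ℕ × ℕ))
    [IsProbabilityMeasure π] (hπ : Kernel.Invariant W.kernel π) (z : ℕ × ℕ) :
    π {z} * ∑' n, W.pathLaw z (stayIn {z}ᶜ n) ≤ 1 := by
  -- By stationarity, avoiding `z` at times `1, …, n + 1` is as likely under `π` as avoiding it at
  -- times `0, …, n`; the term at `z` is the difference, and the sum telescopes.
  have key : ∀ n, (∫⁻ w, W.pathLaw w (stayIn {z}ᶜ (n + 1)) ∂π) +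
      π {z} * W.pathLaw z (stayIn {z}ᶜ n) = ∫⁻ w, W.pathLaw w (stayIn {z}ᶜ n) ∂π := by
    intro n
    have h1 : ∫⁻ w, W.pathLaw w (stayIn {z}ᶜ (n + 1)) ∂π =
        ∫⁻ w in {z}ᶜ, W.pathLaw w (stayIn {z}ᶜ n) ∂π := by
      conv_rhs => rw [← hπ.def]
      rw [← lintegral_indicator (measurableSet_singleton z).compl,
        Measure.lintegral_bind W.kernel.measurable.aemeasurable
          (measurable_of_countable _).aemeasurable]
      refine lintegral_congr fun w => ?_
      rw [lintegral_indicator (measurableSet_singleton z).compl, pathLaw_stayIn_succ]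
      rfl
    rw [h1, add_comm, mul_comm]
    conv_rhs => rw [← lintegral_add_compl _ (measurableSet_singleton z), lintegral_singleton]
  have sum : ∀ n, (∫⁻ w, W.pathLaw w (stayIn {z}ᶜ n) ∂π) +
      π {z} * ∑ k ∈ Finset.range n, W.pathLaw z (stayIn {z}ᶜ k) = 1 := by
    intro n
    induction n with
    | zero => simp [stayIn_zero]
    | succ n ih => rw [Finset.sum_range_succ_comm, mul_add, ← add_assoc, key, ih]
  rw [ENNReal.tsum_eq_iSup_nat, ENNReal.mul_iSup]
  exact iSup_le fun n => le_add_self.trans (sum n).le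

/-- Tail-sum formula: `stayIn {z}ᶜ n` is the event that the return time exceeds `n`. -/
lemma returnTime_le_tsum (z : ℕ × ℕ) (ω : ℕ → ℕ × ℕ) :
    returnTime z ω ≤ ∑' n, (stayIn {z}ᶜ n).indicator 1 ω := by
  classical
  by_cases h : ∃ n, 1 ≤ n ∧ ω n = z
  · calc returnTime z ω ≤ (Nat.find h : ℝ≥0∞) := iInf₂_le (Nat.find h) (Nat.find_spec h)
      _ = ∑ n ∈ Finset.range (Nat.find h), (stayIn {z}ᶜ n).indicator 1 ω := by
        rw [Finset.sum_congr rfl (g := fun _ => (1 : ℝ≥0∞))]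
        · simp
        · intro n hn
          have : ω ∈ stayIn {z}ᶜ n := fun k h1 h2 h3 =>
            Nat.find_min h (h2.trans_lt (Finset.mem_range.1 hn)) ⟨h1, h3⟩
          simp [this]
      _ ≤ _ := ENNReal.sum_le_tsum _
  · have : ∀ n, ω ∈ stayIn {z}ᶜ n := fun n k h1 _ h3 => h ⟨k, h1, h3⟩
    simp [this]

/-- A walk with a stationary distribution of full support is positive recurrent. -/
lemma isPositiveRecurrent_of_invariant (W : QuadrantWalk) (π : Measure (ℕ × ℕ))
    [IsProbabilityMeasure π] (hπ : Kernel.Invariant W.kernel π) (hpos : ∀ z, π {z} ≠ 0) :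
    W.IsPositiveRecurrent := by
  intro z
  calc ∫⁻ ω, returnTime z ω ∂W.pathLaw z
      ≤ ∫⁻ ω, ∑' n, (stayIn {z}ᶜ n).indicator 1 ω ∂W.pathLaw z :=
        lintegral_mono (returnTime_le_tsum z)
    _ = ∑' n, W.pathLaw z (stayIn {z}ᶜ n) := by
        rw [lintegral_tsum fun n =>
          (measurable_one.indicator (measurableSet_stayIn _ n)).aemeasurable]
        simp [measurableSet_stayIn]
    _ < ∞ := by
        refine lt_top_iff_ne_top.2 fun h => ?_
        have := W.measure_mul_tsum_pathLaw_stayIn_le π hπ z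
        rw [h, ENNReal.mul_top (hpos z)] at this
        simp at this

/-- The return time is an empty infimum, hence `∞`, on trajectories that never return. -/
lemma IsPositiveRecurrent.isRecurrent {W : QuadrantWalk} (h : W.IsPositiveRecurrent) :
    W.IsRecurrent := by
  intro z
  rw [← prob_compl_eq_zero_iff (measurableSet_returns z)]
  by_contra h0
  refine (h z).ne (top_le_iff.1 ?_)
  calc ∞ = ∞ * W.pathLaw z {ω | ∃ n, 1 ≤ n ∧ ω n = z}ᶜ := (ENNReal.top_mul h0).symm
    _ = ∫⁻ ω in {ω | ∃ n, 1 ≤ n ∧ ω n = z}ᶜ, ∞ ∂W.pathLaw z := by simp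
    _ ≤ ∫⁻ ω in {ω | ∃ n, 1 ≤ n ∧ ω n = z}ᶜ, returnTime z ω ∂W.pathLaw z := by
        refine setLIntegral_mono' (measurableSet_returns z).compl fun ω hω => ?_
        exact le_iInf₂ fun n hn => absurd ⟨n, hn⟩ hω
    _ ≤ _ := setLIntegral_le_lintegral _ _

lemma IsTransient.not_isRecurrent {W : QuadrantWalk} (h : W.IsTransient) : ¬ W.IsRecurrent :=
  fun h' => (h (0, 0)).ne (h' (0, 0))

/-! ### Irreducibility of elliptic walks -/

/-- The one-step transitions of positive probability. -/
def CanStep (W : QuadrantWalk) (z w : ℕ × ℕ) : Prop := W.step z {w} ≠ 0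

lemma IsElliptic.reflTransGen_canStep {W : QuadrantWalk} (h : W.IsElliptic) (z w : ℕ × ℕ) :
    Relation.ReflTransGen W.CanStep z w := by
  have hr : ∀ i j, W.CanStep (i, j) (i + 1, j) := fun i j => by
    simp [CanStep, step, (h (i, j)).1.ne']
  have hu : ∀ i j, W.CanStep (i, j) (i, j + 1) := fun i j => by
    simp [CanStep, step, (h (i, j)).2.1.ne']
  have hl : ∀ i j, W.CanStep (i + 1, j) (i, j) := fun i j => by
    simp [CanStep, step, ((h (i + 1, j)).2.2.1 (by simp)).ne']
  have hd : ∀ i j, W.CanStep (i, j + 1) (i, j) := fun i j => by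
    simp [CanStep, step, ((h (i, j + 1)).2.2.2 (by simp)).ne']
  have h1 : ∀ i j, Relation.ReflTransGen W.CanStep (i, j) (0, j) := fun i j => by
    induction i with
    | zero => rfl
    | succ i ih => exact .head (hl i j) ih
  have h2 : ∀ j, Relation.ReflTransGen W.CanStep (0, j) (0, 0) := fun j => by
    induction j with
    | zero => rfl
    | succ j ih => exact .head (hd 0 j) ih
  have h3 : ∀ j, Relation.ReflTransGen W.CanStep (0, 0) (0, j) := fun j => by
    induction j with
    | zero => rfl
    | succ j ih => exact ih.tail (hu 0 j)
  have h4 : ∀ i j, Relation.ReflTransGen W.CanStep (0, j) (i, j) := fun i j => by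
    induction i with
    | zero => rfl
    | succ i ih => exact ih.tail (hr i j)
  exact (((h1 z.1 z.2).trans (h2 z.2)).trans (h3 w.2)).trans (h4 w.1 w.2)

lemma pathLaw_eq_iterate (W : QuadrantWalk) (z w : ℕ × ℕ) (n : ℕ) :
    W.pathLaw z {ω | ω n = w} = ((W.killed Set.univ)^[n] (Set.indicator {w} 1)) z := by
  rw [← setLIntegral_stayIn, stayIn_univ, Measure.restrict_univ,
    ← lintegral_map (f := Set.indicator {w} 1) (g := fun ω : ℕ → ℕ × ℕ => ω n)
      (measurable_of_countable _) (by fun_prop),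
    lintegral_indicator_one (measurableSet_singleton w),
    Measure.map_apply (by fun_prop) (measurableSet_singleton w)]
  rfl

lemma IsElliptic.isIrreducible {W : QuadrantWalk} (h : W.IsElliptic) : W.IsIrreducible := by
  intro z w
  induction h.reflTransGen_canStep z w using Relation.ReflTransGen.head_induction_on with
  | refl => exact ⟨0, by simp [pathLaw_eq_iterate]⟩
  | @head z v hzv _ ih =>
    obtain ⟨n, hn⟩ := ih
    refine ⟨n + 1, ?_⟩
    rw [pathLaw_eq_iterate, Function.iterate_succ_apply']
    rw [pathLaw_eq_iterate] at hn
    calc 0 < ((W.killed Set.univ)^[n] (Set.indicator {w} 1)) v * W.step z {v} :=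
          ENNReal.mul_pos hn.ne' hzv
      _ = ∫⁻ x in {v}, ((W.killed Set.univ)^[n] (Set.indicator {w} 1)) x ∂W.step z := by
          rw [lintegral_singleton]
      _ ≤ _ := lintegral_mono_set (Set.subset_univ _)

/-! ### Superharmonic functions and transience -/

/-- A nonnegative superharmonic function `h` dominates `h z` times the probability of hitting
`z`. -/
lemma superharmonic_le_add (W : QuadrantWalk) (h : ℕ × ℕ → ℝ≥0∞)
    (hh : ∀ w, ∫⁻ v, h v ∂W.step w ≤ h w) (z w : ℕ × ℕ) (n : ℕ) :
    h z ≤ h w + h z * W.pathLaw w (stayIn {z}ᶜ n) := by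
  induction n generalizing w with
  | zero => simp [stayIn_zero]
  | succ n ih =>
    rw [pathLaw_stayIn_succ, ← lintegral_indicator (measurableSet_singleton z).compl,
      ← lintegral_const_mul _ (measurable_of_countable _)]
    calc h z = ∫⁻ _, h z ∂W.step w := by simp
      _ ≤ ∫⁻ v, (h v + h z * ({z}ᶜ : Set (ℕ × ℕ)).indicator
            (fun v => W.pathLaw v (stayIn {z}ᶜ n)) v) ∂W.step w := by
          refine lintegral_mono fun v => ?_
          by_cases hv : v = z
          · simp [hv]
          · simpa [hv] using ih v
      _ = _ := lintegral_add_left (measurable_of_countable _) _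
      _ ≤ _ := by gcongr; exact hh w

/-- If the walk returns to `z` almost surely, it hits `z` almost surely from every state that
it can reach from `z`. -/
lemma tendsto_pathLaw_stayIn_of_canStep (W : QuadrantWalk) (z w : ℕ × ℕ)
    (hz : Filter.Tendsto (fun n => W.pathLaw z (stayIn {z}ᶜ n)) Filter.atTop (nhds 0))
    (hzw : Relation.ReflTransGen W.CanStep z w) :
    Filter.Tendsto (fun n => W.pathLaw w (stayIn {z}ᶜ n)) Filter.atTop (nhds 0) := by
  induction hzw with
  | refl => exact hz
  | @tail w v _ hwv ih =>
    by_cases hv : v = z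
    · exact hv ▸ hz
    -- As `v ≠ z`, stepping to `v` and then avoiding `z` is one way to avoid it from `w`; divide by
    -- the probability of that step.
    have h1 := ENNReal.Tendsto.mul_const (b := (W.step w {v})⁻¹)
      ((Filter.tendsto_add_atTop_iff_nat 1).2 ih) (.inr (ENNReal.inv_ne_top.2 hwv))
    rw [zero_mul] at h1
    refine tendsto_of_tendsto_of_tendsto_of_le_of_le tendsto_const_nhds h1 (fun _ => zero_le)
      fun n => ?_
    simp only
    rw [← div_eq_mul_inv, ENNReal.le_div_iff_mul_le (.inl hwv) (.inl (measure_ne_top _ _)),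
      pathLaw_stayIn_succ, ← lintegral_singleton (fun v => W.pathLaw v (stayIn {z}ᶜ n))]
    exact lintegral_mono_set (by simpa using Ne.symm hv)

/-- An elliptic walk with a nonconstant nonnegative superharmonic function is transient. -/
lemma IsElliptic.isTransient_of_superharmonic {W : QuadrantWalk} (hW : W.IsElliptic)
    (h : ℕ × ℕ → ℝ≥0∞) (hh : ∀ w, ∫⁻ v, h v ∂W.step w ≤ h w) (htop : ∀ w, h w ≠ ∞)
    (hne : ∃ v w, h v ≠ h w) : W.IsTransient := by
  intro z
  refine lt_of_le_of_ne prob_le_one fun h1 => ?_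
  have hz : Filter.Tendsto (fun n => W.pathLaw z (stayIn {z}ᶜ n)) Filter.atTop (nhds 0) := by
    have := tendsto_measure_iInter_atTop (μ := W.pathLaw z)
      (fun n => (measurableSet_stayIn {z}ᶜ n).nullMeasurableSet) (antitone_stayIn _)
      ⟨0, measure_ne_top _ _⟩
    rwa [← compl_setOf_returns, (prob_compl_eq_zero_iff (measurableSet_returns z)).2 h1] at this
  -- Since `z` is hit almost surely from `w`, the error term in `superharmonic_le_add` tends to
  -- zero.
  have hmin : ∀ w, h z ≤ h w := fun w => by
    have h2 := (ENNReal.Tendsto.const_mul (a := h z) (W.tendsto_pathLaw_stayIn_of_canStep z w hz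
      (hW.reflTransGen_canStep z w)) (.inr (htop z))).const_add (h w)
    rw [mul_zero, add_zero] at h2
    exact ge_of_tendsto' h2 (W.superharmonic_le_add h hh z w)
  have hconst : ∀ w, h w = h z := fun w => by
    induction hW.reflTransGen_canStep z w with
    | refl => rfl
    | @tail w v _ hwv ih =>
      -- Minimum principle: at a minimum the one-step mean is at most the minimum, so every
      -- accessible neighbour attains it.
      have h3 : (fun _ => h z) =ᵐ[W.step w] h :=
        ae_eq_of_ae_le_of_lintegral_le (.of_forall hmin) (by simpa using htop z)
          (measurable_of_countable _).aemeasurable (by simpa [ih] using hh w)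
      by_contra hne
      exact hwv (measure_mono_null (by simpa using Ne.symm hne) (ae_iff.1 h3))
  obtain ⟨v, w, hvw⟩ := hne
  exact hvw ((hconst v).trans (hconst w).symm)

end QuadrantWalk

/-! ### Balance equations -/

namespace QuadrantWalk

/-- The balance equations imply invariance. -/
lemma invariant_withDensity_count (W : QuadrantWalk) (g : ℕ × ℕ → ℝ≥0)
    (hg : ∀ i j, g (i + 1, j) * W.left (i + 1, j) +
      (if i = 0 then 0 else g (i - 1, j) * W.right (i - 1, j)) +
      (if j = 0 then 0 else g (i, j - 1) * W.up (i, j - 1)) +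
      g (i, j + 1) * W.down (i, j + 1) = g (i, j)) :
    Kernel.Invariant W.kernel (Measure.count.withDensity fun z => (g z : ℝ≥0∞)) := by
  classical
  refine Measure.ext_of_singleton fun ⟨i, j⟩ => ?_
  have hL : ∑' w : ℕ × ℕ, (g w : ℝ≥0∞) * (W.left w * if (w.1 - 1, w.2) = (i, j) then 1 else 0) =
      g (i + 1, j) * W.left (i + 1, j) := by
    rw [tsum_eq_single (i + 1, j)]
    · simp
    · rintro ⟨k, l⟩ h
      -- Truncated subtraction fixes `(0, l)`, but the weight of that left move is zero.
      rcases k with _ | k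
      · simp [W.left_boundary]
      · simp_all
  have hR : ∑' w : ℕ × ℕ, (g w : ℝ≥0∞) * (W.right w * if (w.1 + 1, w.2) = (i, j) then 1 else 0) =
      ((if i = 0 then 0 else g (i - 1, j) * W.right (i - 1, j) : ℝ≥0) : ℝ≥0∞) := by
    rcases i with _ | i
    · simp
    · rw [tsum_eq_single (i, j)]
      · simp
      · rintro ⟨k, l⟩ h
        simp_all
  have hU : ∑' w : ℕ × ℕ, (g w : ℝ≥0∞) * (W.up w * if (w.1, w.2 + 1) = (i, j) then 1 else 0) =
      ((if j = 0 then 0 else g (i, j - 1) * W.up (i, j - 1) : ℝ≥0) : ℝ≥0∞) := by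
    rcases j with _ | j
    · simp
    · rw [tsum_eq_single (i, j)]
      · simp
      · rintro ⟨k, l⟩ h
        simp_all
  have hD : ∑' w : ℕ × ℕ, (g w : ℝ≥0∞) * (W.down w * if (w.1, w.2 - 1) = (i, j) then 1 else 0) =
      g (i, j + 1) * W.down (i, j + 1) := by
    rw [tsum_eq_single (i, j + 1)]
    · simp
    · rintro ⟨k, l⟩ h
      rcases l with _ | l
      · simp [W.down_boundary]
      · simp_all
  have hstep : ∀ w, W.kernel w {(i, j)} =
      W.left w * (if (w.1 - 1, w.2) = (i, j) then 1 else 0) +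
      W.right w * (if (w.1 + 1, w.2) = (i, j) then 1 else 0) +
      W.up w * (if (w.1, w.2 + 1) = (i, j) then 1 else 0) +
      W.down w * (if (w.1, w.2 - 1) = (i, j) then 1 else 0) := fun w => by
    change W.step w {(i, j)} = _
    rw [← lintegral_indicator_one (measurableSet_singleton _), lintegral_step]
    simp only [Set.indicator, Set.mem_singleton_iff, Pi.one_apply]
  rw [Measure.bind_apply (measurableSet_singleton _) W.kernel.measurable.aemeasurable,
    lintegral_withDensity_eq_lintegral_mul _ (measurable_of_countable _) (measurable_of_countable _),
    lintegral_count, withDensity_apply _ (measurableSet_singleton _), lintegral_singleton,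
    Measure.count_singleton, mul_one, ← hg i j]
  simp only [Pi.mul_apply, hstep, mul_add, ENNReal.tsum_add, hL, hR, hU, hD, ENNReal.coe_add,
    ENNReal.coe_mul]

end QuadrantWalk

lemma onRegions_eq_of_iff (o x y q : ℝ≥0) {z z' : ℕ × ℕ} (h1 : z.1 = 0 ↔ z'.1 = 0)
    (h2 : z.2 = 0 ↔ z'.2 = 0) : onRegions o x y q z = onRegions o x y q z' := by
  rcases z with ⟨_ | i, _ | j⟩ <;> rcases z' with ⟨_ | i', _ | j'⟩ <;> simp_all [onRegions]

lemma summable_stationaryWeight : Summable stationaryWeight := by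
  have h : Summable fun n : ℕ => (5 / 7 : ℝ) ^ n :=
    summable_geometric_of_lt_one (by norm_num) (by norm_num)
  have h2 := h.mul_of_nonneg h (fun n => by positivity) (fun n => by positivity)
  rw [← NNReal.summable_coe]
  refine h2.of_nonneg_of_le (fun z => NNReal.coe_nonneg _) fun z => ?_
  rw [← pow_add, stationaryWeight]
  push_cast
  refine mul_le_of_le_one_left (by positivity) ?_
  rcases z with ⟨_ | i, _ | j⟩ <;> norm_num [onRegions]

lemma stationaryWeight_pos (z : ℕ × ℕ) : 0 < stationaryWeight z := by
  refine mul_pos ?_ (by positivity)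
  rcases z with ⟨_ | i, _ | j⟩ <;> norm_num [onRegions]

/-! ### The two explicit walks -/

namespace QuadrantWalk

/-- The transient walk `X`. -/
noncomputable def transientWalk : QuadrantWalk where
  left := onRegions 0 (1 / 10) 0 (21 / 100)
  right := onRegions (9 / 14) (41 / 100) (1 / 25) (4 / 100)
  up := onRegions (5 / 14) (49 / 100) (5 / 25) (1 / 100)
  down := onRegions 0 0 (19 / 25) (74 / 100)
  sum_eq_one z := by
    apply NNReal.coe_injective
    rcases z with ⟨_ | i, _ | j⟩ <;> norm_num [onRegions]
  left_boundary j := by cases j <;> rfl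
  down_boundary i := by cases i <;> rfl

/-- The positive recurrent walk `Y`. -/
noncomputable def recurrentWalk : QuadrantWalk where
  left := onRegions 0 (1 / 12) 0 (5 / 24)
  right := onRegions (9 / 14) (5 / 12) (1 / 20) (1 / 24)
  up := onRegions (5 / 14) (1 / 2) (5 / 24) (3 / 8)
  down := onRegions 0 0 (89 / 120) (3 / 8)
  sum_eq_one z := by
    apply NNReal.coe_injective
    rcases z with ⟨_ | i, _ | j⟩ <;> norm_num [onRegions]
  left_boundary j := by cases j <;> rfl
  down_boundary i := by cases i <;> rfl

lemma isElliptic_transientWalk : transientWalk.IsElliptic := by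
  rintro ⟨_ | i, _ | j⟩ <;> norm_num [transientWalk, onRegions]

lemma isElliptic_recurrentWalk : recurrentWalk.IsElliptic := by
  rintro ⟨_ | i, _ | j⟩ <;> norm_num [recurrentWalk, onRegions]

lemma isMaximallyHomogeneous_transientWalk : transientWalk.IsMaximallyHomogeneous :=
  fun _ _ h1 h2 => ⟨onRegions_eq_of_iff _ _ _ _ h1 h2, onRegions_eq_of_iff _ _ _ _ h1 h2,
    onRegions_eq_of_iff _ _ _ _ h1 h2, onRegions_eq_of_iff _ _ _ _ h1 h2⟩

lemma isMaximallyHomogeneous_recurrentWalk : recurrentWalk.IsMaximallyHomogeneous :=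
  fun _ _ h1 h2 => ⟨onRegions_eq_of_iff _ _ _ _ h1 h2, onRegions_eq_of_iff _ _ _ _ h1 h2,
    onRegions_eq_of_iff _ _ _ _ h1 h2, onRegions_eq_of_iff _ _ _ _ h1 h2⟩

lemma transientWalk_precedes_recurrentWalk : transientWalk ⪯ recurrentWalk := by
  rintro ⟨_ | i, _ | j⟩ <;> refine ⟨?_, ?_, ?_, ?_⟩ <;> rw [← NNReal.coe_le_coe] <;>
    norm_num [transientWalk, recurrentWalk, onRegions]

/-- A superharmonic function for the transient walk. -/
noncomputable def escapeFunction (z : ℕ × ℕ) : ℝ≥0 :=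
  min 1 ((9 / 10) ^ z.1 * (26 / 25) ^ z.2)

lemma sum_escapeFunction_le (z : ℕ × ℕ) :
    transientWalk.left z * escapeFunction (z.1 - 1, z.2) +
      transientWalk.right z * escapeFunction (z.1 + 1, z.2) +
      transientWalk.up z * escapeFunction (z.1, z.2 + 1) +
      transientWalk.down z * escapeFunction (z.1, z.2 - 1) ≤ escapeFunction z := by
  have hle : ∀ w, escapeFunction w ≤ 1 := fun w => min_le_left _ _
  have hone : transientWalk.left z * escapeFunction (z.1 - 1, z.2) +
      transientWalk.right z * escapeFunction (z.1 + 1, z.2) +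
      transientWalk.up z * escapeFunction (z.1, z.2 + 1) +
      transientWalk.down z * escapeFunction (z.1, z.2 - 1) ≤ 1 := by
    rw [← transientWalk.sum_eq_one z]
    gcongr <;> exact mul_le_of_le_one_right' (hle _)
  have hf : ∀ w : ℕ × ℕ, escapeFunction w ≤ (9 / 10) ^ w.1 * (26 / 25) ^ w.2 :=
    fun w => min_le_right _ _
  refine le_min hone ?_
  -- On the `y`-axis the product is at least `1`, so the trivial bound suffices. Elsewhere one step
  -- multiplies the product on average by about `0.990` on the `x`-axis and `0.991` in the interior.
  rcases z with ⟨_ | i, j⟩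
  · exact hone.trans (by simpa using one_le_pow₀ (by rw [← NNReal.coe_le_coe]; norm_num))
  · refine le_trans (add_le_add (add_le_add (add_le_add (mul_le_mul_right (hf _) _)
      (mul_le_mul_right (hf _) _)) (mul_le_mul_right (hf _) _)) (mul_le_mul_right (hf _) _)) ?_
    rw [← NNReal.coe_le_coe]
    rcases j with _ | j
    · have : (0 : ℝ) < (9 / 10) ^ i := by positivity
      simp only [transientWalk, onRegions]
      push_cast [pow_succ]
      simp only [pow_zero]
      linarith
    · have : (0 : ℝ) < (9 / 10) ^ i * (26 / 25) ^ j := by positivity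
      simp only [transientWalk, onRegions]
      push_cast [pow_succ]
      linarith

lemma isTransient_transientWalk : transientWalk.IsTransient := by
  refine isElliptic_transientWalk.isTransient_of_superharmonic (fun z => escapeFunction z)
    (fun w => ?_) (fun w => ENNReal.coe_ne_top) ⟨(0, 0), (1, 0), ?_⟩
  · rw [lintegral_step]
    exact_mod_cast sum_escapeFunction_le w
  · have h : (9 / 10 : ℝ≥0) < 1 := by rw [← NNReal.coe_lt_coe]; norm_num
    simp only [escapeFunction, ne_eq, ENNReal.coe_inj]
    simpa using h.le.lt_of_ne h.ne |>.not_ge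

lemma balance_stationaryWeight (i j : ℕ) :
    stationaryWeight (i + 1, j) * recurrentWalk.left (i + 1, j) +
      (if i = 0 then 0 else stationaryWeight (i - 1, j) * recurrentWalk.right (i - 1, j)) +
      (if j = 0 then 0 else stationaryWeight (i, j - 1) * recurrentWalk.up (i, j - 1)) +
      stationaryWeight (i, j + 1) * recurrentWalk.down (i, j + 1) = stationaryWeight (i, j) := by
  apply NNReal.coe_injective
  -- States at distance `1` from an axis are separate cases, since they receive mass from the axis,
  -- where weights and rates differ.
  rcases i with _ | _ | i <;> rcases j with _ | _ | j <;>
    simp [recurrentWalk, onRegions, stationaryWeight] <;> ring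

/-- The stationary distribution of the positive recurrent walk. -/
noncomputable def stationaryMeasure : Measure (ℕ × ℕ) :=
  Measure.count.withDensity fun z =>
    ((stationaryWeight z / ∑' w, stationaryWeight w : ℝ≥0) : ℝ≥0∞)

lemma stationaryMeasure_singleton (z : ℕ × ℕ) : stationaryMeasure {z} =
    ((stationaryWeight z / ∑' w, stationaryWeight w : ℝ≥0) : ℝ≥0∞) := by
  rw [stationaryMeasure, withDensity_apply _ (measurableSet_singleton _), lintegral_singleton,
    Measure.count_singleton, mul_one]

lemma tsum_stationaryWeight_pos : 0 < ∑' w, stationaryWeight w :=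
  (stationaryWeight_pos (0, 0)).trans_le (summable_stationaryWeight.le_tsum' (0, 0))

instance : IsProbabilityMeasure stationaryMeasure where
  measure_univ := by
    rw [stationaryMeasure, withDensity_apply _ .univ, Measure.restrict_univ, lintegral_count,
      ← ENNReal.coe_tsum (summable_stationaryWeight.div_const _), tsum_div_const,
      div_self tsum_stationaryWeight_pos.ne', ENNReal.coe_one]

lemma invariant_stationaryMeasure : Kernel.Invariant recurrentWalk.kernel stationaryMeasure := by
  refine invariant_withDensity_count _ _ fun i j => ?_
  rw [← balance_stationaryWeight i j]
  split_ifs <;> simp only [add_div, div_mul_eq_mul_div, zero_div]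

lemma isPositiveRecurrent_recurrentWalk : recurrentWalk.IsPositiveRecurrent :=
  recurrentWalk.isPositiveRecurrent_of_invariant _ invariant_stationaryMeasure fun z => by
    rw [stationaryMeasure_singleton]
    exact_mod_cast (div_pos (stationaryWeight_pos z) tsum_stationaryWeight_pos).ne'

end QuadrantWalk

theorem mainTheorem1 :
    (∃ X Y : QuadrantWalk,
      -- the main assertion
      X.IsElliptic ∧ Y.IsElliptic ∧ X ⪯ Y ∧ Y.IsPositiveRecurrent ∧ X.IsTransient ∧
      X.IsIrreducible ∧ Y.IsIrreducible ∧
      X.IsMaximallyHomogeneous ∧ Y.IsMaximallyHomogeneous ∧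
      -- the transition probabilities of the transient walk
      X.left = onRegions 0 (1 / 10) 0 (21 / 100) ∧
      X.right = onRegions (9 / 14) (41 / 100) (1 / 25) (4 / 100) ∧
      X.up = onRegions (5 / 14) (49 / 100) (5 / 25) (1 / 100) ∧
      X.down = onRegions 0 0 (19 / 25) (74 / 100) ∧
      -- the transition probabilities of the positive recurrent walk
      Y.left = onRegions 0 (1 / 12) 0 (5 / 24) ∧
      Y.right = onRegions (9 / 14) (5 / 12) (1 / 20) (1 / 24) ∧
      Y.up = onRegions (5 / 14) (1 / 2) (5 / 24) (3 / 8) ∧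
      Y.down = onRegions 0 0 (89 / 120) (3 / 8) ∧
      -- the stationary distribution of the positive recurrent walk
      ∃ (Z : NNReal) (π : MeasureTheory.Measure (ℕ × ℕ)),
        HasSum stationaryWeight Z ∧ (∀ z, π {z} = ((stationaryWeight z / Z : NNReal) : ENNReal)) ∧
        MeasureTheory.IsProbabilityMeasure π ∧ ProbabilityTheory.Kernel.Invariant Y.kernel π) ∧
    -- recurrence is not monotone
    ¬ (∀ X Y : QuadrantWalk, X.IsIrreducible → Y.IsIrreducible → X ⪯ Y →
        Y.IsRecurrent → X.IsRecurrent) := by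
  open QuadrantWalk in
  exact ⟨⟨transientWalk, recurrentWalk, isElliptic_transientWalk, isElliptic_recurrentWalk,
    transientWalk_precedes_recurrentWalk, isPositiveRecurrent_recurrentWalk,
    isTransient_transientWalk, isElliptic_transientWalk.isIrreducible,
    isElliptic_recurrentWalk.isIrreducible, isMaximallyHomogeneous_transientWalk,
    isMaximallyHomogeneous_recurrentWalk, rfl, rfl, rfl, rfl, rfl, rfl, rfl, rfl,
    _, stationaryMeasure, summable_stationaryWeight.hasSum, stationaryMeasure_singleton,
    inferInstance, invariant_stationaryMeasure⟩,
    fun h => isTransient_transientWalk.not_isRecurrent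
      (h _ _ isElliptic_transientWalk.isIrreducible isElliptic_recurrentWalk.isIrreducible
        transientWalk_precedes_recurrentWalk isPositiveRecurrent_recurrentWalk.isRecurrent)⟩
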